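/- Let $m\ge 1$, let $\mathcal M$ be a compact smooth manifold of dimension $m$ (without boundary; for instance a compact submanifold of $\mathbb R^D$) with a smooth Riemannian metric $g$ and geodesic distance $d$, and let $p\in[1,\infty)$. For linearly independent $X,Y\in T_x\mathcal M$ let $$K_x(X,Y)=\frac{\mathbf R_x(X,Y,Y,X)}{g_x(X,X)\,g_x(Y,Y)-g_x(X,Y)^2}$$ be the sectional curvature of $g$, where $\mathbf R$ is the Riemann curvature tensor; a metric has sectional curvature bounded by $K$ if $|K_x(X,Y)|\le K$ for all $x\in\mathcal M$ and all linearly independent $X,Y\in T_x\mathcal M$. Let $\rho:\mathcal M\to\mathbb R$ satisfy, for some $\beta>0$ and real $L_1,L_2$: 1. $\frac1\beta\le\rho(x)\le\beta$ for all $x\in\mathcal M$; 2. $\rho\in C^\infty(\mathcal M)$; 3. $|\rho(x)-\rho(y)|\le L_1\,d(x,y)$ for all $x,y\in\mathcal M$ (no condition if $d(x,y)=\infty$); 4. $\|\nabla^2\rho(x)\|\le L_2$ for all $x\in\mathcal M$, i.e. the Riemannian Hessian of $\rho$ satisfies $|\nabla^2\rho(x)(X,Y)|\le L_2\,|X|_g|Y|_g$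 for all $X,Y\in T_x\mathcal M$. Put $\alpha=2(p-1)/m$, and let $g_p=\rho^{-\alpha}g$ be the Fermat metric. If $(\mathcal M,g)$ has sectional curvature bounded by $K$, then $(\mathcal M,g_p)$ has sectional curvature bounded by $$K_p=\beta^{\alpha}\left(K+\frac{3\beta^2(p-1)^2L_1^2}{m^2}+\frac{2\beta^2(p-1)L_1^2}{m}+\frac{2\beta(p-1)L_2}{m}\right).$$ -/

import Mathlib

open scoped Manifold ContDiff Bundle ENNReal

noncomputable section

namespace Fermat

/-! ### Coordinate formulas

`G` is a metric in coordinates: a field of bilinear forms on a vector space `E`. -/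

section Coordinates

variable {E : Type*} [NormedAddCommGroup E] [NormedSpace ℝ E]

/-- The Christoffel map `Γ_y(u, v)` of the Levi-Civita connection of `G`, characterised by
`2 G_y(Γ_y(u, v), w) = (∂_u G)(v, w) + (∂_v G)(u, w) - (∂_w G)(u, v)`. In a basis,
`Γ(e_i, e_j) = Γ^k_{ij} e_k`. Here `G_y : E → E*` is invertible whenever `G_y` is an inner product
on a finite-dimensional space. -/
def christoffel (G : E → E →L[ℝ] E →L[ℝ] ℝ) (y u v : E) : E :=
  (G y).inverse ((2⁻¹ : ℝ) •
    (fderiv ℝ G y u v + fderiv ℝ G y v u - ((fderiv ℝ G y).flip u).flip v))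

/-- The curvature `R(X, Y)Z = ∇_X ∇_Y Z - ∇_Y ∇_X Z` at `y`, evaluated on constant (hence
commuting) coordinate vector fields; `∇_X Z = DZ(X) + Γ(X, Z)`. -/
def curvature (G : E → E →L[ℝ] E →L[ℝ] ℝ) (y X Y Z : E) : E :=
  fderiv ℝ (fun z ↦ christoffel G z Y Z) y X - fderiv ℝ (fun z ↦ christoffel G z X Z) y Y
    + christoffel G y X (christoffel G y Y Z) - christoffel G y Y (christoffel G y X Z)

/-- The covariant Hessian `(∇²f)(u, v) = D²f(u, v) - Df(Γ(u, v))` in coordinates. -/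
def coordHessian (G : E → E →L[ℝ] E →L[ℝ] ℝ) (f : E → ℝ) (y u v : E) : ℝ :=
  fderiv ℝ (fderiv ℝ f) y u v - fderiv ℝ f y (christoffel G y u v)

end Coordinates

/-! ### Riemannian geometry of a manifold modelled on `ℝᵐ` -/

section Manifold

variable {m : ℕ} {M : Type*} [TopologicalSpace M] [ChartedSpace (EuclideanSpace ℝ (Fin m)) M]
  [IsManifold (𝓡 m) ∞ M]

variable (m M) in
/-- A smooth Riemannian metric on the tangent bundle of `M`. -/
abbrev Metric : Type _ :=
  Bundle.ContMDiffRiemannianMetric (𝓡 m) ∞ (EuclideanSpace ℝ (Fin m))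
    (fun x : M ↦ TangentSpace (𝓡 m) x)

/-- The geodesic distance of `g`: the infimum of the `g`-lengths of `C¹` paths, with value `∞` for
points in different connected components. -/
def geodesicEDist (g : Metric m M) (x y : M) : ℝ≥0∞ :=
  letI : Bundle.RiemannianBundle (fun x : M ↦ TangentSpace (𝓡 m) x) := ⟨g.toRiemannianMetric⟩
  Manifold.riemannianEDist (𝓡 m) x y

/-- The metric `g` in the chart at `x`: the pullback of `g` by the inverse chart. -/
def metricInChart (g : Metric m M) (x : M) (y : EuclideanSpace ℝ (Fin m)) :
    EuclideanSpace ℝ (Fin m) →L[ℝ] EuclideanSpace ℝ (Fin m) →L[ℝ] ℝ :=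
  let φ := (extChartAt (𝓡 m) x).symm
  let dφ : EuclideanSpace ℝ (Fin m) →L[ℝ] TangentSpace (𝓡 m) (φ y) :=
    mfderiv 𝓘(ℝ, EuclideanSpace ℝ (Fin m)) (𝓡 m) φ y
  dφ.precomp ℝ ∘L g.inner (φ y) ∘L dφ

/-- The coordinates of a tangent vector at `x` in the chart at `x`. -/
def tangentCoord (x : M) (X : TangentSpace (𝓡 m) x) : EuclideanSpace ℝ (Fin m) :=
  mfderiv (𝓡 m) 𝓘(ℝ, EuclideanSpace ℝ (Fin m)) (extChartAt (𝓡 m) x) x X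

/-- The Riemannian curvature tensor `R(X, Y, Z, W) = g(R(X, Y)Z, W)` at `x`, computed in the chart
at `x`. -/
def riemannTensor (g : Metric m M) (x : M) (X Y Z W : TangentSpace (𝓡 m) x) : ℝ :=
  let G := metricInChart g x
  let y := extChartAt (𝓡 m) x x
  G y (curvature G y (tangentCoord x X) (tangentCoord x Y) (tangentCoord x Z)) (tangentCoord x W)

/-- The sectional curvature `R(X, Y, Y, X) / (g(X, X) g(Y, Y) - g(X, Y)²)` of the plane spanned by
linearly independent `X`, `Y`. -/
def sectionalCurvature (g : Metric m M) (x : M) (X Y : TangentSpace (𝓡 m) x) : ℝ :=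
  riemannTensor g x X Y Y X / (g.inner x X X * g.inner x Y Y - g.inner x X Y ^ 2)

/-- All sectional curvatures of `g` are bounded by `K` in absolute value. -/
def SectionalCurvatureBoundedBy (g : Metric m M) (K : ℝ) : Prop :=
  ∀ (x : M) (X Y : TangentSpace (𝓡 m) x), LinearIndependent ℝ ![X, Y] →
    |sectionalCurvature g x X Y| ≤ K

/-- The Riemannian Hessian `(∇²f)_x(X, Y)`, computed in the chart at `x`. -/
def hessian (g : Metric m M) (f : M → ℝ) (x : M) (X Y : TangentSpace (𝓡 m) x) : ℝ :=
  coordHessian (metricInChart g x) (f ∘ (extChartAt (𝓡 m) x).symm) (extChartAt (𝓡 m) x x)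
    (tangentCoord x X) (tangentCoord x Y)

/-- The metric `c g` for a smooth positive function `c`. -/
def conformalMetric (g : Metric m M) (c : M → ℝ) (hc : ContMDiff (𝓡 m) 𝓘(ℝ) ∞ c)
    (hpos : ∀ x, 0 < c x) : Metric m M where
  inner x := c x • g.inner x
  symm x v w := by
    change c x * g.inner x v w = c x * g.inner x w v
    rw [g.symm]
  pos x v hv := mul_pos (hpos x) (g.pos x v hv)
  isVonNBounded x := by
    have hs : 0 < √(c x) := Real.sqrt_pos.2 (hpos x)
    refine ((g.isVonNBounded x).image
      ((√(c x))⁻¹ • ContinuousLinearMap.id ℝ (TangentSpace (𝓡 m) x))).subset ?_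
    intro v hv
    refine ⟨√(c x) • v, ?_, ?_⟩
    · change g.inner x (√(c x) • v) (√(c x) • v) < 1
      have hv' : c x * g.inner x v v < 1 := hv
      simp only [map_smul, smul_apply, smul_eq_mul]
      rwa [← mul_assoc, Real.mul_self_sqrt (hpos x).le]
    · change (√(c x))⁻¹ • (√(c x) • v) = v
      rw [smul_smul, inv_mul_cancel₀ hs.ne', one_smul]
  contMDiff := by
    have := hc.smul_section (F := EuclideanSpace ℝ (Fin m) →L[ℝ] EuclideanSpace ℝ (Fin m) →L[ℝ] ℝ)
      (V := fun x : M ↦ TangentSpace (𝓡 m) x →L[ℝ] TangentSpace (𝓡 m) x →L[ℝ] ℝ) g.contMDiff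
    exact this

/-- The Fermat metric `g_p = ρ^{-α} g` with `α = 2(p - 1)/m`. -/
def fermatMetric (g : Metric m M) (ρ : M → ℝ) (hρ : ContMDiff (𝓡 m) 𝓘(ℝ) ∞ ρ)
    (hpos : ∀ x, 0 < ρ x) (p : ℝ) : Metric m M :=
  conformalMetric g (fun x ↦ ρ x ^ (-(2 * (p - 1) / m)))
    (fun x ↦ (Real.contDiffAt_rpow_const_of_ne (hpos x).ne').contMDiffAt.comp x (hρ x))
    (fun x ↦ Real.rpow_pos_of_pos (hpos x) _)

end Manifold

end Fermat

end

/-!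
The curvature of the conformal metric `e^{2φ} g` is computed in a chart. Subtracting the Koszul
formulas for the two metrics gives
`Γ̃(u, v) = Γ(u, v) + dφ(u) v + dφ(v) u - g(u, v) ∇φ` (`christoffel_conformal`). Differentiating this
and using compatibility of `Γ` with `g` yields (`apply_curvature_conformal`)
`g(R̃(X, Y)Y, X) = g(R(X, Y)Y, X) - (T(X, X) g(Y, Y) + T(Y, Y) g(X, X) - 2 T(X, Y) g(X, Y))`
with `T = ∇²φ - dφ ⊗ dφ + ½ |dφ|² g`.

For the Fermat metric, `φ = -a log ρ` with `a = (p - 1) / m`, so that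
`∇²φ = -a (∇²ρ / ρ - dρ ⊗ dρ / ρ²)`. As `1 / ρ ≤ β`, `|dρ| ≤ |L₁|` and `|∇²ρ| ≤ L₂`, this gives
`|T(v, v)| ≤ C |v|²` with `C = a β L₂ + a β² L₁² + (3/2) a² β² L₁²` (`abs_schoutenChange_le`).
The correction term does not change when `Y` is made orthogonal to `X`, and is therefore at most
`2 C` times the Gram determinant (`abs_kulkarniNomizu_le`). Dividing by the Gram determinant, which
scales by `ρ ^ (-2 α)` while the lowered curvature tensor scales by `ρ ^ (-α)`, leaves
`ρ ^ α (K + 2 C)`, which is at most the claimed bound.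

The bound `|dρ| ≤ |L₁|` comes from the Lipschitz condition by comparing the geodesic distance with
the length of short coordinate segments (`abs_fderiv_le_of_lipschitz`).
-/

noncomputable section
namespace Fermat
open Filter Topology

/-! ### Normed structures on spaces of multilinear forms -/

section ConformalChange


set_option synthInstance.maxHeartbeats 200000

variable {E : Type*} [NormedAddCommGroup E] [NormedSpace ℝ E]

/-- The operator norm on bilinear forms: Mathlib's instance, given explicitly to shorten the
search. -/
instance instNormedAddCommGroupBilin : NormedAddCommGroup (E →L[ℝ] E →L[ℝ] ℝ) :=
  ContinuousLinearMap.toNormedAddCommGroup (𝕜 := ℝ) (𝕜₂ := ℝ) (E := E) (σ₁₂ := RingHom.id ℝ)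
    (F := E →L[ℝ] ℝ)

instance instNormedSpaceBilin : NormedSpace ℝ (E →L[ℝ] E →L[ℝ] ℝ) :=
  ContinuousLinearMap.toNormedSpace (𝕜 := ℝ) (𝕜₂ := ℝ) (E := E) (σ₁₂ := RingHom.id ℝ)
    (F := E →L[ℝ] ℝ)

/-- The operator norm on trilinear forms, where the derivative of a metric in coordinates takes its
values. It is Mathlib's norm, which instance search does not find on three nested spaces of maps. -/
instance instNormedAddCommGroupTrilin : NormedAddCommGroup (E →L[ℝ] E →L[ℝ] E →L[ℝ] ℝ) :=
  ContinuousLinearMap.toNormedAddCommGroup (𝕜 := ℝ) (𝕜₂ := ℝ) (E := E) (σ₁₂ := RingHom.id ℝ)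
    (F := E →L[ℝ] E →L[ℝ] ℝ)

instance instNormedSpaceTrilin : NormedSpace ℝ (E →L[ℝ] E →L[ℝ] E →L[ℝ] ℝ) :=
  ContinuousLinearMap.toNormedSpace (𝕜 := ℝ) (𝕜₂ := ℝ) (E := E) (σ₁₂ := RingHom.id ℝ)
    (F := E →L[ℝ] E →L[ℝ] ℝ)

/-! ### The Christoffel map -/

variable {G : E → E →L[ℝ] E →L[ℝ] ℝ} {φ : E → ℝ} {y : E}

/-- The Koszul formula. -/
lemma apply_christoffel (h : (G y).IsInvertible) (u v w : E) :
    G y (christoffel G y u v) w =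
      2⁻¹ * (fderiv ℝ G y u v w + fderiv ℝ G y v u w - fderiv ℝ G y w u v) := by
  simp [christoffel, h.self_apply_inverse]

lemma christoffel_add_right (u v w : E) :
    christoffel G y u (v + w) = christoffel G y u v + christoffel G y u w := by
  simp only [christoffel, ← map_add]
  congr 1
  ext z
  simp
  ring

lemma christoffel_smul_right (u v : E) (c : ℝ) :
    christoffel G y u (c • v) = c • christoffel G y u v := by
  simp only [christoffel, ← map_smul]
  congr 1
  ext z
  simp
  ring

lemma christoffel_sub_right (u v w : E) :
    christoffel G y u (v - w) = christoffel G y u v - christoffel G y u w := by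
  rw [sub_eq_add_neg, christoffel_add_right, ← neg_one_smul ℝ w, christoffel_smul_right]
  simp [sub_eq_add_neg]

lemma fderiv_symm_of_symm (hG : DifferentiableAt ℝ G y)
    (hs : ∀ᶠ z in 𝓝 y, ∀ u v, G z u v = G z v u) (w u v : E) :
    fderiv ℝ G y w u v = fderiv ℝ G y w v u := by
  have h1 : ∀ a b : E, fderiv ℝ (fun z ↦ G z a b) y w = fderiv ℝ G y w a b := by
    intro a b
    rw [fderiv_clm_apply (by fun_prop) (by fun_prop), fderiv_clm_apply (by fun_prop) (by fun_prop)]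
    simp
  rw [← h1, ← h1]
  have : (fun z ↦ G z u v) =ᶠ[𝓝 y] fun z ↦ G z v u := hs.mono fun z hz ↦ hz u v
  rw [this.fderiv_eq]

lemma christoffel_symm (hG : DifferentiableAt ℝ G y)
    (hs : ∀ᶠ z in 𝓝 y, ∀ u v, G z u v = G z v u) (u v : E) :
    christoffel G y u v = christoffel G y v u := by
  simp only [christoffel]
  congr 2
  ext w
  simp [fderiv_symm_of_symm hG hs w u v]
  ring

/-- The Levi-Civita connection is compatible with the metric. -/
lemma fderiv_metric_eq (hG : DifferentiableAt ℝ G y)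
    (hs : ∀ᶠ z in 𝓝 y, ∀ u v, G z u v = G z v u) (h : (G y).IsInvertible) (u v w : E) :
    fderiv ℝ G y u v w =
      G y (christoffel G y u v) w + G y (christoffel G y u w) v := by
  rw [apply_christoffel h, apply_christoffel h, fderiv_symm_of_symm hG hs w u v,
    fderiv_symm_of_symm hG hs u w v, fderiv_symm_of_symm hG hs v u w]
  ring

/-! ### Curvature under a conformal change of metric -/

/-- The gradient of `φ` with respect to `G`. -/
def coordGradient (G : E → E →L[ℝ] E →L[ℝ] ℝ) (φ : E → ℝ) (y : E) : E :=
  (G y).inverse (fderiv ℝ φ y)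

lemma apply_coordGradient (h : (G y).IsInvertible) (u : E) :
    G y (coordGradient G φ y) u = fderiv ℝ φ y u := by
  rw [coordGradient, h.self_apply_inverse]

lemma christoffel_conformal (hG : DifferentiableAt ℝ G y) (hφ : DifferentiableAt ℝ φ y)
    (h : (G y).IsInvertible) (u v : E) :
    christoffel (fun z ↦ Real.exp (2 * φ z) • G z) y u v =
      christoffel G y u v + (fderiv ℝ φ y u • v + fderiv ℝ φ y v • u
        - G y u v • coordGradient G φ y) := by
  have hd : ∀ a b c : E, fderiv ℝ (fun z ↦ Real.exp (2 * φ z) • G z) y a b c =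
      Real.exp (2 * φ y) * (fderiv ℝ G y a b c + 2 * fderiv ℝ φ y a * G y b c) := by
    intro a b c
    have : DifferentiableAt ℝ (fun z ↦ Real.exp (2 * φ z)) y := by fun_prop
    rw [fderiv_fun_smul this hG, fderiv_exp (by fun_prop), fderiv_const_mul hφ]
    simp
    ring
  have hinv : (Real.exp (2 * φ y) • G y).IsInvertible := by
    obtain ⟨e, he⟩ := h
    refine ⟨(ContinuousLinearEquiv.smulLeft
      (Units.mk0 (Real.exp (2 * φ y)) (Real.exp_ne_zero _))).trans e, ?_⟩
    ext a b
    simp [← he]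
  have inverse_eq_of : ∀ f : E →L[ℝ] ℝ, ∀ x : E, f = (Real.exp (2 * φ y) • G y) x →
      (Real.exp (2 * φ y) • G y).inverse f = x := fun f x hx ↦ (hinv.inverse_apply_eq).2 hx
  rw [christoffel]
  apply inverse_eq_of
  ext w
  have := apply_christoffel h u v w
  simp [hd, this, apply_coordGradient h]
  ring

lemma contDiffAt_inverse_apply [CompleteSpace E] {n : WithTop ℕ∞} {f : E → E →L[ℝ] ℝ}
    (hG : ContDiffAt ℝ n G y)
    (h : (G y).IsInvertible) (hf : ContDiffAt ℝ n f y) :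
    ContDiffAt ℝ n (fun z ↦ (G z).inverse (f z)) y :=
  (h.contDiffAt_map_inverse.comp y hG).clm_apply hf

lemma differentiableAt_christoffel [CompleteSpace E]
    (hG : ContDiffAt ℝ 2 G y) (h : (G y).IsInvertible) (u v : E) :
    DifferentiableAt ℝ (fun z ↦ christoffel G z u v) y := by
  have hd : ContDiffAt ℝ 1 (fderiv ℝ G) y := hG.fderiv_right (by norm_num)
  refine (contDiffAt_inverse_apply (n := 1) (hG.of_le (by norm_num)) h ?_).differentiableAt
    (by norm_num)
  have h1 : ContDiffAt ℝ 1 (fun z ↦ ((fderiv ℝ G z).flip u).flip v) y := by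
    have : ContDiffAt ℝ 1 (fun z ↦ (fderiv ℝ G z).flip) y :=
      (ContinuousLinearMap.flipₗᵢ ℝ E E (E →L[ℝ] ℝ)).toContinuousLinearEquiv.contDiff.contDiffAt.comp
        y hd
    exact ((ContinuousLinearMap.flipₗᵢ ℝ E E ℝ).toContinuousLinearEquiv.contDiff.contDiffAt.comp
        y (this.clm_apply contDiffAt_const)).clm_apply contDiffAt_const
  exact (((hd.clm_apply contDiffAt_const).clm_apply contDiffAt_const).add
    ((hd.clm_apply contDiffAt_const).clm_apply contDiffAt_const) |>.sub h1).const_smul _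

/-- The tensor `T = ∇²φ - dφ ⊗ dφ + ½ |dφ|² G`; in dimension at least three, `-T` is the change of
the Schouten tensor when `G` is replaced by `e^{2φ} G`. -/
def schoutenChange (G : E → E →L[ℝ] E →L[ℝ] ℝ) (φ : E → ℝ) (y u v : E) : ℝ :=
  coordHessian G φ y u v - fderiv ℝ φ y u * fderiv ℝ φ y v
    + 2⁻¹ * fderiv ℝ φ y (coordGradient G φ y) * G y u v

lemma fderiv_christoffel_conformal [CompleteSpace E] (hG : ContDiffAt ℝ 2 G y)
    (hφ : ContDiffAt ℝ 2 φ y) (hi : ∀ᶠ z in 𝓝 y, (G z).IsInvertible) (u v w : E) :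
    fderiv ℝ (fun z ↦ christoffel (fun z ↦ Real.exp (2 * φ z) • G z) z u v) y w =
      fderiv ℝ (fun z ↦ christoffel G z u v) y w +
      (fderiv ℝ (fderiv ℝ φ) y w u • v + fderiv ℝ (fderiv ℝ φ) y w v • u
        - fderiv ℝ G y w u v • coordGradient G φ y
        - G y u v • fderiv ℝ (coordGradient G φ) y w) := by
  have hev : (fun z ↦ christoffel (fun z ↦ Real.exp (2 * φ z) • G z) z u v) =ᶠ[𝓝 y]
      fun z ↦ christoffel G z u v + (fderiv ℝ φ z u • v + fderiv ℝ φ z v • u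
        - G z u v • coordGradient G φ z) := by
    filter_upwards [hi, hG.eventually (by simp), hφ.eventually (by simp)] with z h1 h2 h3
    exact christoffel_conformal (h2.differentiableAt (by norm_num))
      (h3.differentiableAt (by norm_num)) h1 u v
  have hdG := hG.differentiableAt (by norm_num)
  have hdφ : ContDiffAt ℝ 1 (fderiv ℝ φ) y := hφ.fderiv_right (by norm_num)
  have hddφ := hdφ.differentiableAt (by norm_num)
  have hN : DifferentiableAt ℝ (coordGradient G φ) y :=
    (contDiffAt_inverse_apply (n := 1) (hG.of_le (by norm_num)) hi.self_of_nhds hdφ).differentiableAt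
      (by norm_num)
  have hΓ := differentiableAt_christoffel hG hi.self_of_nhds u v
  have h1 : ∀ a : E, DifferentiableAt ℝ (fun z ↦ fderiv ℝ φ z a) y := fun a ↦ by fun_prop
  have h2 : DifferentiableAt ℝ (fun z ↦ G z u v) y := by fun_prop
  have e1 : ∀ a : E, fderiv ℝ (fun z ↦ fderiv ℝ φ z a) y w = fderiv ℝ (fderiv ℝ φ) y w a := by
    intro a
    rw [fderiv_clm_apply (by fun_prop) (by fun_prop)]; simp
  have e2 : fderiv ℝ (fun z ↦ G z u v) y w = fderiv ℝ G y w u v := by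
    rw [fderiv_clm_apply (by fun_prop) (by fun_prop), fderiv_clm_apply (by fun_prop) (by fun_prop)]
    simp
  rw [hev.fderiv_eq, fderiv_fun_add hΓ (by fun_prop), fderiv_fun_sub (by fun_prop) (by fun_prop),
    fderiv_fun_add (by fun_prop) (by fun_prop), fderiv_smul_const (h1 u), fderiv_smul_const (h1 v),
    fderiv_fun_smul h2 hN]
  simp only [add_apply, sub_apply,
    ContinuousLinearMap.smulRight_apply, smul_apply, e1, e2]
  module

/-- The derivative of the identity `G(∇φ, u) = dφ(u)`. -/
lemma apply_fderiv_coordGradient [CompleteSpace E] (hG : ContDiffAt ℝ 2 G y)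
    (hφ : ContDiffAt ℝ 2 φ y) (hi : ∀ᶠ z in 𝓝 y, (G z).IsInvertible) (w u : E) :
    G y (fderiv ℝ (coordGradient G φ) y w) u =
      fderiv ℝ (fderiv ℝ φ) y w u - fderiv ℝ G y w (coordGradient G φ y) u := by
  have hdG := hG.differentiableAt (by norm_num)
  have hdφ : ContDiffAt ℝ 1 (fderiv ℝ φ) y := hφ.fderiv_right (by norm_num)
  have hN : DifferentiableAt ℝ (coordGradient G φ) y :=
    (contDiffAt_inverse_apply (n := 1) (hG.of_le (by norm_num)) hi.self_of_nhds hdφ).differentiableAt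
      (by norm_num)
  have hev : fderiv ℝ φ =ᶠ[𝓝 y] fun z ↦ G z (coordGradient G φ z) := by
    filter_upwards [hi] with z hz
    ext u
    rw [apply_coordGradient hz]
  rw [hev.fderiv_eq, fderiv_clm_apply hdG hN]
  simp

/-- The curvature of `e^{2φ} G`, lowered with `G` itself rather than with `e^{2φ} G`. -/
theorem apply_curvature_conformal [CompleteSpace E] (hG : ContDiffAt ℝ 2 G y)
    (hφ : ContDiffAt ℝ 2 φ y) (hi : ∀ᶠ z in 𝓝 y, (G z).IsInvertible)
    (hs : ∀ᶠ z in 𝓝 y, ∀ u v, G z u v = G z v u) (X Y : E) :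
    G y (curvature (fun z ↦ Real.exp (2 * φ z) • G z) y X Y Y) X =
      G y (curvature G y X Y Y) X -
        (schoutenChange G φ y X X * G y Y Y + schoutenChange G φ y Y Y * G y X X
          - (schoutenChange G φ y X Y + schoutenChange G φ y Y X) * G y X Y) := by
  have h := hi.self_of_nhds
  have hdG := hG.differentiableAt (by norm_num)
  have hdφ := hφ.differentiableAt (by norm_num)
  have hsym := hs.self_of_nhds
  have hD2 : fderiv ℝ (fderiv ℝ φ) y Y X = fderiv ℝ (fderiv ℝ φ) y X Y :=
    (hφ.isSymmSndFDerivAt (by simp)).eq Y X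
  have hΓ := christoffel_symm hdG hs X Y
  set N := coordGradient G φ y with hN
  have hNu : ∀ u, G y u N = fderiv ℝ φ y u := fun u ↦ by rw [hsym, apply_coordGradient h]
  have hNv : ∀ u, G y N u = fderiv ℝ φ y u := fun u ↦ by rw [apply_coordGradient h]
  -- expand everything in terms of `G`, `dφ`, `D²φ` and the Christoffel map of `G`, replacing the
  -- derivatives of `G` by metric compatibility; what remains is a polynomial identity
  simp only [curvature, fderiv_christoffel_conformal hG hφ hi, christoffel_conformal hdG hdφ h,
    christoffel_add_right, christoffel_sub_right, christoffel_smul_right, schoutenChange,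
    coordHessian]
  simp only [map_add, map_sub, map_smul, add_apply,
    sub_apply, smul_apply, smul_eq_mul,
    apply_fderiv_coordGradient hG hφ hi, fderiv_metric_eq hdG hs h, ← hN, hNu, hNv, hD2, ← hΓ,
    hsym Y X]
  rw [hsym (christoffel G y Y Y) X, hsym (christoffel G y X Y) X,
    hsym (christoffel G y X Y) Y]
  ring

end ConformalChange

/-! ### The metric in a chart -/

/-- A positive definite form on a finite-dimensional space identifies it with its dual. -/
lemma isInvertible_of_pos {E : Type*} [NormedAddCommGroup E] [NormedSpace ℝ E]
    [FiniteDimensional ℝ E] (B : E →L[ℝ] E →L[ℝ] ℝ) (hB : ∀ v, v ≠ 0 → 0 < B v v) :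
    B.IsInvertible := by
  have hinj : Function.Injective (B : E →ₗ[ℝ] E →L[ℝ] ℝ) := by
    rw [injective_iff_map_eq_zero]
    intro v hv
    by_contra h
    have h1 := hB v h
    have h2 : B v = 0 := hv
    simp [h2] at h1
  have hdim : Module.finrank ℝ E = Module.finrank ℝ (E →L[ℝ] ℝ) := by
    rw [← Subspace.dual_finrank_eq (K := ℝ) (V := E)]
    exact (LinearMap.toContinuousLinearMap (𝕜 := ℝ) (E := E) (F' := ℝ)).finrank_eq
  have : FiniteDimensional ℝ (E →L[ℝ] ℝ) :=
    (LinearMap.toContinuousLinearMap (𝕜 := ℝ) (E := E) (F' := ℝ)).finiteDimensional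
  refine ⟨(LinearEquiv.ofInjectiveOfFinrankEq (B : E →ₗ[ℝ] E →L[ℝ] ℝ) hinj
    hdim).toContinuousLinearEquiv, ?_⟩
  ext u v
  rfl

variable {m : ℕ} {M : Type*} [TopologicalSpace M] [ChartedSpace (EuclideanSpace ℝ (Fin m)) M]
  [IsManifold (𝓡 m) ∞ M]

lemma metricInChart_apply (g : Metric m M) (x : M) (y u v : EuclideanSpace ℝ (Fin m)) :
    metricInChart g x y u v = g.inner ((extChartAt (𝓡 m) x).symm y)
      (mfderiv 𝓘(ℝ, EuclideanSpace ℝ (Fin m)) (𝓡 m) (extChartAt (𝓡 m) x).symm y u)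
      (mfderiv 𝓘(ℝ, EuclideanSpace ℝ (Fin m)) (𝓡 m) (extChartAt (𝓡 m) x).symm y v) := rfl

lemma metricInChart_symm (g : Metric m M) (x : M) (y u v : EuclideanSpace ℝ (Fin m)) :
    metricInChart g x y u v = metricInChart g x y v u := by
  rw [metricInChart_apply, metricInChart_apply, g.symm]

/-- The derivative at `x` of the chart at `x` is the identity: the tangent space at `x` is by
definition the model space, read in that chart. -/
lemma tangentCoord_eq (x : M) (X : TangentSpace (𝓡 m) x) : tangentCoord x X = X := by
  rw [tangentCoord, mfderiv_extChartAt_self]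
  rfl

lemma metricInChart_tangentCoord (g : Metric m M) (x : M) (X Y : TangentSpace (𝓡 m) x) :
    metricInChart g x (extChartAt (𝓡 m) x x) (tangentCoord x X) (tangentCoord x Y)
      = g.inner x X Y := by
  -- the base point `x` only agrees propositionally with its image under the chart and its inverse
  have key : ∀ x' : M, x' = x → ∀ U V : EuclideanSpace ℝ (Fin m),
      g.inner x' U V = g.inner x U V := by rintro _ rfl _ _; rfl
  have h := mfderivWithin_range_extChartAt_symm (I := 𝓡 m) (x := x)
  rw [ModelWithCorners.range_eq_univ, mfderivWithin_univ] at h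
  rw [metricInChart_apply, tangentCoord_eq, tangentCoord_eq]
  have h1 : ∀ X : EuclideanSpace ℝ (Fin m), mfderiv 𝓘(ℝ, EuclideanSpace ℝ (Fin m)) (𝓡 m)
    (extChartAt (𝓡 m) x).symm (extChartAt (𝓡 m) x x) X = X := fun X ↦ by rw [h]; rfl
  have h2 := key _ (extChartAt_to_inv (I := 𝓡 m) x)
    (mfderiv 𝓘(ℝ, EuclideanSpace ℝ (Fin m)) (𝓡 m)
    (extChartAt (𝓡 m) x).symm (extChartAt (𝓡 m) x x) X)
    (mfderiv 𝓘(ℝ, EuclideanSpace ℝ (Fin m)) (𝓡 m)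
    (extChartAt (𝓡 m) x).symm (extChartAt (𝓡 m) x x) Y)
  refine h2.trans ?_
  exact congrArg₂ (fun a b ↦ g.inner x a b) (h1 X) (h1 Y)

lemma metricInChart_pos (g : Metric m M) (x : M) {y : EuclideanSpace ℝ (Fin m)}
    (hy : y ∈ (extChartAt (𝓡 m) x).target) (v : EuclideanSpace ℝ (Fin m)) (hv : v ≠ 0) :
    0 < metricInChart g x y v v := by
  rw [metricInChart_apply]
  refine g.pos _ _ fun h0 ↦ hv ?_
  have h := isInvertible_mfderivWithin_extChartAt_symm (I := 𝓡 m) hy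
  rw [ModelWithCorners.range_eq_univ, mfderivWithin_univ] at h
  obtain ⟨e, he⟩ := h
  rw [← he] at h0
  exact (map_eq_zero_iff e e.injective).1 h0

lemma contMDiffAt_extChartAt_symm (x : M) {y : EuclideanSpace ℝ (Fin m)}
    (hy : y ∈ (extChartAt (𝓡 m) x).target) :
    ContMDiffAt 𝓘(ℝ, EuclideanSpace ℝ (Fin m)) (𝓡 m) ∞ (extChartAt (𝓡 m) x).symm y :=
  (contMDiffOn_extChartAt_symm x).contMDiffAt ((isOpen_extChartAt_target x).mem_nhds hy)


/-- The derivative of `f : E → M` in a fixed direction `u` is a smooth section along `f`. -/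
lemma contMDiffAt_mfderiv_const {E : Type*} [NormedAddCommGroup E] [NormedSpace ℝ E]
    {f : E → M} {s : Set E} (hs : IsOpen s) (hf : ContMDiffOn 𝓘(ℝ, E) (𝓡 m) ∞ f s) {y : E}
    (hy : y ∈ s) (u : E) :
    ContMDiffAt 𝓘(ℝ, E) ((𝓡 m).prod 𝓘(ℝ, EuclideanSpace ℝ (Fin m))) ∞
      (fun z ↦ Bundle.TotalSpace.mk' (EuclideanSpace ℝ (Fin m))
        (E := fun x : M ↦ TangentSpace (𝓡 m) x) (f z) (mfderiv 𝓘(ℝ, E) (𝓡 m) f z u)) y := by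
  have htan := hf.contMDiffOn_tangentMapWithin (m := ∞) (by simp) hs.uniqueMDiffOn
  have h1 : ContMDiff 𝓘(ℝ, E) (𝓘(ℝ, E).prod 𝓘(ℝ, E)) ∞
      (fun z : E ↦ (⟨z, u⟩ : TangentBundle 𝓘(ℝ, E) E)) :=
    contMDiff_vectorSpace_iff_contDiff.2 contDiff_const
  have h2 := (htan.comp h1.contMDiffOn (s := s) (fun z hz ↦ hz)).contMDiffAt (hs.mem_nhds hy)
  refine h2.congr_of_eventuallyEq ?_
  filter_upwards [hs.mem_nhds hy] with z hz
  simp only [Function.comp, tangentMapWithin, mfderivWithin_of_isOpen hs hz]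

lemma contDiffAt_metricInChart (g : Metric m M) (x : M) {y : EuclideanSpace ℝ (Fin m)}
    (hy : y ∈ (extChartAt (𝓡 m) x).target) : ContDiffAt ℝ ∞ (metricInChart g x) y := by
  have hopen := isOpen_extChartAt_target (I := 𝓡 m) x
  refine ContDiffOn.contDiffAt ?_ (hopen.mem_nhds hy)
  -- in finite dimension it suffices that the coefficients `g(dψ u, dψ v)` are smooth, where `ψ` is the
  -- inverse chart
  refine contDiffOn_clm_apply.2 fun u ↦ contDiffOn_clm_apply.2 fun v z hz ↦ ?_
  refine ContDiffAt.contDiffWithinAt ?_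
  have hsec := contMDiffAt_mfderiv_const hopen (contMDiffOn_extChartAt_symm (n := ∞) x) hz
  have hg := g.contMDiff.contMDiffAt.comp z (contMDiffAt_extChartAt_symm x hz)
  have h := ContMDiffAt.clm_bundle_apply₂ (F₁ := EuclideanSpace ℝ (Fin m))
    (F₂ := EuclideanSpace ℝ (Fin m)) (F₃ := ℝ) (E₁ := fun x : M ↦ TangentSpace (𝓡 m) x)
    (E₂ := fun x : M ↦ TangentSpace (𝓡 m) x) (E₃ := Bundle.Trivial M ℝ) hg (hsec u) (hsec v)
  have h' := (Bundle.contMDiffAt_totalSpace.1 h).2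
  exact h'.contDiffAt

/-! ### Lipschitz functions have bounded gradient -/

variable {m : ℕ} {M : Type*} [TopologicalSpace M] [ChartedSpace (EuclideanSpace ℝ (Fin m)) M]
  [IsManifold (𝓡 m) ∞ M]

lemma geodesicEDist_le_of_speed_le (g : Metric m M) {γ : ℝ → M} {a b c : ℝ} (hab : a ≤ b)
    (hγ : ContMDiffOn 𝓘(ℝ) (𝓡 m) 1 γ (Set.Icc a b))
    (hc : ∀ t ∈ Set.Icc a b,
      √(g.inner (γ t) (mfderiv 𝓘(ℝ) (𝓡 m) γ t (1 : ℝ)) (mfderiv 𝓘(ℝ) (𝓡 m) γ t (1 : ℝ))) ≤ c) :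
    geodesicEDist g (γ a) (γ b) ≤ ENNReal.ofReal (c * (b - a)) := by
  have hc0 : 0 ≤ c := (Real.sqrt_nonneg _).trans (hc a (Set.left_mem_Icc.2 hab))
  let _ : Bundle.RiemannianBundle (fun x : M ↦ TangentSpace (𝓡 m) x) := ⟨g.toRiemannianMetric⟩
  have h := Manifold.riemannianEDist_le_pathELength hγ rfl rfl hab
  refine (show geodesicEDist g (γ a) (γ b) ≤ Manifold.pathELength (𝓡 m) γ a b from h).trans ?_
  rw [Manifold.pathELength_eq_lintegral_mfderiv_Icc]
  have hle : ∀ t ∈ Set.Icc a b, ‖mfderiv 𝓘(ℝ) (𝓡 m) γ t (1 : ℝ)‖ₑ ≤ ENNReal.ofReal c := by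
    intro t ht
    rw [← ofReal_norm]
    refine ENNReal.ofReal_le_ofReal ?_
    rw [norm_eq_sqrt_real_inner]
    exact hc t ht
  refine (MeasureTheory.setLIntegral_mono measurable_const hle).trans ?_
  rw [MeasureTheory.setLIntegral_const, Real.volume_Icc, ENNReal.ofReal_mul hc0]

/-- A function that is `L`-Lipschitz for the geodesic distance satisfies `|df| ≤ |L|`, here read in
the chart at `x`. -/
lemma abs_fderiv_le_of_lipschitz (g : Metric m M) {f : M → ℝ} (hf : ContMDiff (𝓡 m) 𝓘(ℝ) ∞ f)
    {L : ℝ} (hL : ∀ x y, geodesicEDist g x y ≠ ⊤ →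
      |f x - f y| ≤ L * (geodesicEDist g x y).toReal) (x : M) (u : EuclideanSpace ℝ (Fin m)) :
    |fderiv ℝ (f ∘ (extChartAt (𝓡 m) x).symm) (extChartAt (𝓡 m) x x) u| ≤
      |L| * √(metricInChart g x (extChartAt (𝓡 m) x x) u u) := by
  set y := extChartAt (𝓡 m) x x with hy
  set ψ := (extChartAt (𝓡 m) x).symm with hψ
  have hyt : y ∈ (extChartAt (𝓡 m) x).target := mem_extChartAt_target x
  have hfd : DifferentiableAt ℝ (f ∘ ψ) y :=
    ((hf.contMDiffAt.comp y (contMDiffAt_extChartAt_symm x hyt)).contDiffAt).differentiableAt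
      (by simp)
  set q : ℝ → ℝ := fun t ↦ √(metricInChart g x (y + t • u) u u) with hq
  have hline : Continuous fun t : ℝ ↦ y + t • u := by fun_prop
  have hqc : ContinuousAt q 0 := by
    have h1 : ContinuousAt (metricInChart g x) (y + (0 : ℝ) • u) := by
      simpa using (contDiffAt_metricInChart g x hyt).continuousAt
    have h2 : ContinuousAt (fun t : ℝ ↦ metricInChart g x (y + t • u)) 0 :=
      ContinuousAt.comp (f := fun t : ℝ ↦ y + t • u) h1 hline.continuousAt
    exact ((h2.clm_apply continuousAt_const).clm_apply continuousAt_const).sqrt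
  have hd : HasDerivAt (fun t : ℝ ↦ (f ∘ ψ) (y + t • u)) (fderiv ℝ (f ∘ ψ) y u) 0 := by
    have h1 : HasDerivAt (fun t : ℝ ↦ y + t • u) u 0 := by
      simpa using ((hasDerivAt_id (0 : ℝ)).smul_const u).const_add y
    have h2 : HasFDerivAt (f ∘ ψ) (fderiv ℝ (f ∘ ψ) y) (y + (0 : ℝ) • u) := by
      simpa using hfd.hasFDerivAt
    exact h2.comp_hasDerivAt 0 h1
  refine le_of_forall_pos_le_add fun ε hε ↦ ?_
  -- near `0` the speed of the coordinate line is at most `q 0 + η`, with `|L| η ≤ ε`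
  obtain ⟨η, hη, hηε⟩ : ∃ η > 0, |L| * η ≤ ε :=
    ⟨ε / (|L| + 1), by positivity, by
      rw [mul_div_assoc', div_le_iff₀ (by positivity)]; nlinarith [abs_nonneg L]⟩
  have hev : ∀ᶠ t : ℝ in 𝓝 0, q t < q 0 + η ∧ y + t • u ∈ (extChartAt (𝓡 m) x).target := by
    refine (hqc.eventually_lt continuousAt_const (by linarith)).and ?_
    refine hline.continuousAt.eventually_mem ?_
    simpa using (isOpen_extChartAt_target x).mem_nhds hyt
  obtain ⟨δ, hδ, hball⟩ := Metric.eventually_nhds_iff_ball.1 hev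
  have hγ : ∀ t ∈ Metric.ball (0 : ℝ) δ, ContMDiffAt 𝓘(ℝ) (𝓡 m) ∞ (fun t : ℝ ↦ ψ (y + t • u)) t ∧
      mfderiv 𝓘(ℝ) (𝓡 m) (fun t : ℝ ↦ ψ (y + t • u)) t (1 : ℝ) =
        mfderiv 𝓘(ℝ, EuclideanSpace ℝ (Fin m)) (𝓡 m) ψ (y + t • u) u := by
    intro t ht
    have h1 := contMDiffAt_extChartAt_symm x (hball t ht).2
    have h2 : ContMDiff 𝓘(ℝ) 𝓘(ℝ, EuclideanSpace ℝ (Fin m)) ∞ (fun t : ℝ ↦ y + t • u) := by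
      refine ContDiff.contMDiff ?_
      fun_prop
    refine ⟨ContMDiffAt.comp t h1 h2.contMDiffAt, ?_⟩
    have h3 : HasDerivAt (fun t : ℝ ↦ y + t • u) u t := by
      simpa using ((hasDerivAt_id t).smul_const u).const_add y
    have h4 := mfderiv_comp (I := 𝓘(ℝ)) (I' := 𝓘(ℝ, EuclideanSpace ℝ (Fin m))) (I'' := 𝓡 m)
      (f := fun t : ℝ ↦ y + t • u) (g := ψ) t
      (h1.mdifferentiableAt (by simp)) (h2.contMDiffAt.mdifferentiableAt (by simp))
    have h5 : mfderiv 𝓘(ℝ) 𝓘(ℝ, EuclideanSpace ℝ (Fin m)) (fun t : ℝ ↦ y + t • u) t (1 : ℝ)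
        = u := by
      rw [mfderiv_eq_fderiv, h3.hasFDerivAt.fderiv]
      exact (ContinuousLinearMap.toSpanSingleton_apply ℝ u 1).trans (one_smul ℝ u)
    have h6 := congrArg (fun A ↦ A (1 : ℝ)) h4
    refine h6.trans ?_
    exact congrArg (mfderiv 𝓘(ℝ, EuclideanSpace ℝ (Fin m)) (𝓡 m) ψ (y + t • u)) h5
  have hdist : ∀ a b : ℝ, a ≤ b → a ∈ Metric.ball (0 : ℝ) δ → b ∈ Metric.ball (0 : ℝ) δ →
      |(f ∘ ψ) (y + a • u) - (f ∘ ψ) (y + b • u)| ≤ |L| * (q 0 + η) * (b - a) := by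
    intro a b hab ha hb
    have hsub : Set.Icc a b ⊆ Metric.ball (0 : ℝ) δ := by
      rw [Real.ball_eq_Ioo] at *
      exact (Set.Icc_subset_Ioo ha.1 hb.2)
    have h1 := geodesicEDist_le_of_speed_le g (γ := fun t : ℝ ↦ ψ (y + t • u)) (c := q 0 + η) hab
      (fun t ht ↦ ((hγ t (hsub ht)).1.of_le (by simp)).contMDiffWithinAt) (by
        intro t ht
        rw [(hγ t (hsub ht)).2]
        exact (hball t (hsub ht)).1.le)
    have hq0 : 0 ≤ q 0 + η := add_nonneg (Real.sqrt_nonneg _) hη.le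
    have h2 := hL _ _ (ne_top_of_le_ne_top ENNReal.ofReal_ne_top h1)
    have h3 := ENNReal.toReal_le_of_le_ofReal (mul_nonneg hq0 (sub_nonneg.2 hab)) h1
    calc _ ≤ _ := h2
      _ ≤ |L| * (geodesicEDist g (ψ (y + a • u)) (ψ (y + b • u))).toReal :=
        mul_le_mul_of_nonneg_right (le_abs_self L) ENNReal.toReal_nonneg
      _ ≤ |L| * ((q 0 + η) * (b - a)) := mul_le_mul_of_nonneg_left h3 (abs_nonneg L)
      _ = _ := by ring
  have hlip : ‖ContinuousLinearMap.toSpanSingleton ℝ (fderiv ℝ (f ∘ ψ) y u)‖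
      ≤ |L| * (q 0 + η) := by
    refine hd.hasFDerivAt.le_of_lip'
      (mul_nonneg (abs_nonneg L) (add_nonneg (Real.sqrt_nonneg _) hη.le)) ?_
    filter_upwards [Metric.ball_mem_nhds (0 : ℝ) hδ] with t ht
    have h0 := Metric.mem_ball_self (x := (0 : ℝ)) hδ
    rcases le_total 0 t with h | h
    · have := hdist 0 t h h0 ht
      rw [Real.norm_eq_abs, Real.norm_eq_abs, abs_sub_comm, sub_zero, abs_of_nonneg h]
      simpa using this
    · have := hdist t 0 h ht h0
      rw [Real.norm_eq_abs, Real.norm_eq_abs, sub_zero, abs_of_nonpos h]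
      simpa using this
  rw [ContinuousLinearMap.norm_toSpanSingleton, Real.norm_eq_abs] at hlip
  have hq0 : q 0 = √(metricInChart g x y u u) := by simp [hq]
  rw [← hq0]
  linarith

/-! ### Bounds in coordinates -/

section ConformalFactor

variable {E : Type*} [NormedAddCommGroup E] [NormedSpace ℝ E]
  {G : E → E →L[ℝ] E →L[ℝ] ℝ} {f : E → ℝ} {y : E}

lemma fderiv_neg_mul_log (hf : DifferentiableAt ℝ f y) (hpos : 0 < f y) (a : ℝ) :
    fderiv ℝ (fun z ↦ -a * Real.log (f z)) y = (-a * (f y)⁻¹) • fderiv ℝ f y := by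
  rw [fderiv_const_mul (hf.log hpos.ne'), fderiv.log hf hpos.ne', smul_smul]

lemma coordHessian_neg_mul_log (hf : ContDiffAt ℝ 2 f y) (hpos : 0 < f y) (a : ℝ) (u v : E) :
    coordHessian G (fun z ↦ -a * Real.log (f z)) y u v =
      -a * ((f y)⁻¹ * coordHessian G f y u v - (f y)⁻¹ ^ 2 * (fderiv ℝ f y u * fderiv ℝ f y v)) := by
  have hfd := hf.differentiableAt (by norm_num)
  have hd : DifferentiableAt ℝ (fderiv ℝ f) y :=
    (hf.fderiv_right (m := 1) (by norm_num)).differentiableAt (by norm_num)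
  have hev : fderiv ℝ (fun z ↦ -a * Real.log (f z)) =ᶠ[𝓝 y]
      fun z ↦ (-a * (f z)⁻¹) • fderiv ℝ f z := by
    filter_upwards [hf.eventually (by simp), hf.continuousAt.eventually_const_lt hpos] with z h1 h2
    exact fderiv_neg_mul_log (h1.differentiableAt (by norm_num)) h2 a
  have hinv : HasFDerivAt (fun z ↦ -a * (f z)⁻¹) (-a • (-(f y ^ 2)⁻¹ • fderiv ℝ f y)) y :=
    ((hasDerivAt_inv hpos.ne').comp_hasFDerivAt y hfd.hasFDerivAt).const_mul (-a)
  rw [coordHessian, coordHessian, fderiv_neg_mul_log hfd hpos, hev.fderiv_eq,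
    (hinv.fun_smul hd.hasFDerivAt).fderiv]
  simp
  ring

lemma schoutenChange_smul_add_smul (hG : DifferentiableAt ℝ G y)
    (hs : ∀ᶠ z in 𝓝 y, ∀ u v, G z u v = G z v u) {φ : E → ℝ} (a b : ℝ) (X Y : E) :
    schoutenChange G φ y (a • X + b • Y) (a • X + b • Y) =
      a ^ 2 * schoutenChange G φ y X X
        + a * b * (schoutenChange G φ y X Y + schoutenChange G φ y Y X)
        + b ^ 2 * schoutenChange G φ y Y Y := by
  have hΓ : christoffel G y (a • X + b • Y) (a • X + b • Y) =
      a ^ 2 • christoffel G y X X + (a * b) • christoffel G y X Y + (a * b) • christoffel G y Y X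
        + b ^ 2 • christoffel G y Y Y := by
    rw [christoffel_add_right, christoffel_smul_right, christoffel_smul_right,
      christoffel_symm hG hs _ X, christoffel_symm hG hs _ Y, christoffel_add_right,
      christoffel_add_right, christoffel_smul_right, christoffel_smul_right,
      christoffel_smul_right, christoffel_smul_right]
    module
  simp only [schoutenChange, coordHessian, hΓ]
  simp
  ring

/-- If a bilinear form `T` satisfies `|T(v, v)| ≤ C B(v, v)`, then the value of its Kulkarni–Nomizu
product with `B` on the plane of `X` and `Y` is at most `2 C` times the Gram determinant. Indeed
both the product and the Gram determinant are unchanged when `Y` is made orthogonal to `X`. -/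
lemma abs_kulkarniNomizu_le {B : E →L[ℝ] E →L[ℝ] ℝ} (hB : ∀ v, v ≠ 0 → 0 < B v v)
    (hsym : ∀ u v, B u v = B v u) {T : E → E → ℝ} {C : ℝ} (hT : ∀ v, |T v v| ≤ C * B v v)
    {X Y : E} (hX : X ≠ 0)
    (hbil : ∀ a b : ℝ, T (a • X + b • Y) (a • X + b • Y) =
      a ^ 2 * T X X + a * b * (T X Y + T Y X) + b ^ 2 * T Y Y) :
    |T X X * B Y Y + T Y Y * B X X - (T X Y + T Y X) * B X Y| ≤
      2 * C * (B X X * B Y Y - B X Y ^ 2) := by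
  have hXX := hB X hX
  set gram := B X X * B Y Y - B X Y ^ 2 with hgram
  -- `-B(X, Y) X + B(X, X) Y` is a multiple of the component of `Y` orthogonal to `X`
  have hZZ : B (-B X Y • X + B X X • Y) (-B X Y • X + B X X • Y) = B X X * gram := by
    simp [hsym Y X, hgram]
    ring
  have hTZ := hT (-B X Y • X + B X X • Y)
  have hTX := hT X
  have hgram0 : 0 ≤ gram := by
    by_contra! h
    rcases eq_or_ne (-B X Y • X + B X X • Y) 0 with h0 | h0
    · rw [h0] at hZZ
      simp [hXX.ne'] at hZZ
      exact h.ne hZZ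
    · have := hB _ h0
      rw [hZZ] at this
      nlinarith
  rw [hZZ, hbil] at hTZ
  rw [abs_le] at hTZ hTX ⊢
  have key : B X X * (T X X * B Y Y + T Y Y * B X X - (T X Y + T Y X) * B X Y) =
      ((-B X Y) ^ 2 * T X X + -B X Y * B X X * (T X Y + T Y X) + B X X ^ 2 * T Y Y)
        + T X X * gram := by
    rw [hgram]; ring
  have h1 : T X X * gram ≤ C * B X X * gram := mul_le_mul_of_nonneg_right hTX.2 hgram0
  have h2 : -(C * B X X) * gram ≤ T X X * gram := mul_le_mul_of_nonneg_right hTX.1 hgram0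
  constructor
  · refine le_of_mul_le_mul_left ?_ hXX
    rw [key]; linarith
  · refine le_of_mul_le_mul_left ?_ hXX
    rw [key]; linarith

lemma gram_pos {B : E →L[ℝ] E →L[ℝ] ℝ} (hB : ∀ v, v ≠ 0 → 0 < B v v)
    (hsym : ∀ u v, B u v = B v u) {X Y : E} (h : LinearIndependent ℝ ![X, Y]) :
    0 < B X X * B Y Y - B X Y ^ 2 := by
  have hX : X ≠ 0 := by simpa using h.ne_zero 0
  have hXX := hB X hX
  have hZ : -B X Y • X + B X X • Y ≠ 0 := fun h0 ↦
    hXX.ne' (LinearIndependent.pair_iff.1 h _ _ h0).2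
  have hZZ : B (-B X Y • X + B X X • Y) (-B X Y • X + B X X • Y) =
      B X X * (B X X * B Y Y - B X Y ^ 2) := by
    simp [hsym Y X]
    ring
  have := hB _ hZ
  rw [hZZ] at this
  exact pos_of_mul_pos_right this hXX.le

/-- If `β⁻¹ ≤ f`, `|df| ≤ L₁` and `|∇²f| ≤ L₂`, then the tensor `schoutenChange` of
`φ = -a log f` is bounded on the diagonal. -/
lemma abs_schoutenChange_le (hf : ContDiffAt ℝ 2 f y) (hinv : (G y).IsInvertible)
    (hB : ∀ v, v ≠ 0 → 0 < G y v v) {a β L₁ L₂ : ℝ} (ha : 0 ≤ a)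
    (hpos : 0 < f y) (hβ : (f y)⁻¹ ≤ β) (hL₁ : ∀ v, |fderiv ℝ f y v| ≤ |L₁| * √(G y v v))
    (hL₂ : ∀ v, |coordHessian G f y v v| ≤ L₂ * √(G y v v) * √(G y v v)) (v : E) :
    |schoutenChange G (fun z ↦ -a * Real.log (f z)) y v v| ≤
      (a * β * L₂ + a * β ^ 2 * L₁ ^ 2 + 3 / 2 * a ^ 2 * β ^ 2 * L₁ ^ 2) * G y v v := by
  have hB0 : ∀ v, 0 ≤ G y v v := fun v ↦ by
    rcases eq_or_ne v 0 with rfl | h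
    · simp
    · exact (hB v h).le
  have hfd := hf.differentiableAt (by norm_num)
  have hr : 0 < (f y)⁻¹ := inv_pos.2 hpos
  have hr2 : (f y)⁻¹ ^ 2 ≤ β ^ 2 := pow_le_pow_left₀ hr.le hβ 2
  have hD : ∀ v, fderiv ℝ f y v ^ 2 ≤ L₁ ^ 2 * G y v v := fun v ↦ by
    have := pow_le_pow_left₀ (abs_nonneg _) (hL₁ v) 2
    rwa [sq_abs, mul_pow, sq_abs, Real.sq_sqrt (hB0 v)] at this
  have hH : |coordHessian G f y v v| ≤ L₂ * G y v v := by
    have := hL₂ v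
    rwa [mul_assoc, Real.mul_self_sqrt (hB0 v)] at this
  set φ : E → ℝ := fun z ↦ -a * Real.log (f z) with hφ
  have hdφ : fderiv ℝ φ y = (-a * (f y)⁻¹) • fderiv ℝ f y := fderiv_neg_mul_log hfd hpos a
  set n := fderiv ℝ φ y (coordGradient G φ y) with hn
  have hnG : G y (coordGradient G φ y) (coordGradient G φ y) = n := apply_coordGradient hinv _
  have hn0 : 0 ≤ n := hnG ▸ hB0 _
  -- `|dφ|⁴ = dφ(∇φ)² ≤ a² β² L₁² |dφ|²`
  have hnle : n ≤ a ^ 2 * β ^ 2 * L₁ ^ 2 := by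
    have h1 : n ^ 2 ≤ a ^ 2 * β ^ 2 * L₁ ^ 2 * n := by
      have h2 : n = -a * (f y)⁻¹ * fderiv ℝ f y (coordGradient G φ y) := by
        rw [hn, hdφ]; simp
      have h3 := hD (coordGradient G φ y)
      rw [hnG] at h3
      calc n ^ 2 = a ^ 2 * ((f y)⁻¹ ^ 2 * fderiv ℝ f y (coordGradient G φ y) ^ 2) := by
            rw [h2]; ring
        _ ≤ a ^ 2 * (β ^ 2 * (L₁ ^ 2 * n)) := by gcongr
        _ = _ := by ring
    rcases hn0.eq_or_lt with h | h
    · rw [← h]; positivity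
    · exact le_of_mul_le_mul_right (by linarith [sq n]) h
  have hb := hB0 v
  have hT : schoutenChange G φ y v v =
      -(a * ((f y)⁻¹ * coordHessian G f y v v)) + a * ((f y)⁻¹ ^ 2 * fderiv ℝ f y v ^ 2)
        - a ^ 2 * ((f y)⁻¹ ^ 2 * fderiv ℝ f y v ^ 2) + 2⁻¹ * n * G y v v := by
    rw [schoutenChange, ← hn, coordHessian_neg_mul_log hf hpos, hdφ]
    simp
    ring
  have e1 : |(f y)⁻¹ * coordHessian G f y v v| ≤ β * (L₂ * G y v v) := by
    rw [abs_mul, abs_of_pos hr]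
    exact mul_le_mul hβ hH (abs_nonneg _) (hr.le.trans hβ)
  have e2 : (f y)⁻¹ ^ 2 * fderiv ℝ f y v ^ 2 ≤ β ^ 2 * (L₁ ^ 2 * G y v v) := by
    gcongr
    exact hD v
  have e2' : 0 ≤ (f y)⁻¹ ^ 2 * fderiv ℝ f y v ^ 2 := by positivity
  have e3 : n * G y v v ≤ a ^ 2 * β ^ 2 * L₁ ^ 2 * G y v v := by gcongr
  have e3' : 0 ≤ n * G y v v := mul_nonneg hn0 hb
  rw [abs_le] at e1
  have f1 := mul_le_mul_of_nonneg_left e1.1 ha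
  have f1' := mul_le_mul_of_nonneg_left e1.2 ha
  have f2 := mul_le_mul_of_nonneg_left e2 ha
  have f2' := mul_nonneg ha e2'
  have f3 := mul_le_mul_of_nonneg_left e2 (sq_nonneg a)
  have f3' := mul_nonneg (sq_nonneg a) e2'
  rw [hT, abs_le]
  constructor <;> linarith

end ConformalFactor

/-! ### The Fermat metric -/

variable {m : ℕ} {M : Type*} [TopologicalSpace M] [ChartedSpace (EuclideanSpace ℝ (Fin m)) M]
  [IsManifold (𝓡 m) ∞ M]

lemma metricInChart_fermatMetric (g : Metric m M) (ρ : M → ℝ) (hρ : ContMDiff (𝓡 m) 𝓘(ℝ) ∞ ρ)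
    (hpos : ∀ x, 0 < ρ x) (p : ℝ) (x : M) :
    metricInChart (fermatMetric g ρ hρ hpos p) x = fun z ↦
      Real.exp (2 * (-((p - 1) / m) * Real.log ((ρ ∘ (extChartAt (𝓡 m) x).symm) z))) •
        metricInChart g x z := by
  ext z u v
  have h : ρ ((extChartAt (𝓡 m) x).symm z) ^ (-(2 * (p - 1) / m)) =
      Real.exp (2 * (-((p - 1) / m) * Real.log ((ρ ∘ (extChartAt (𝓡 m) x).symm) z))) := by
    rw [Real.rpow_def_of_pos (hpos _)]
    congr 1
    simp only [Function.comp]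
    ring
  rw [← h]
  rfl

lemma tangentCoord_linearIndependent {x : M} {X Y : TangentSpace (𝓡 m) x}
    (h : LinearIndependent ℝ ![X, Y]) :
    LinearIndependent ℝ ![tangentCoord x X, tangentCoord x Y] := by
  rw [tangentCoord_eq, tangentCoord_eq]
  exact h

end Fermat

theorem theoremB2 {m : ℕ} {M : Type*} [TopologicalSpace M]
    [ChartedSpace (EuclideanSpace ℝ (Fin m)) M] [IsManifold (𝓡 m) ∞ M] [T2Space M] [CompactSpace M]
    (g : Fermat.Metric m M) (ρ : M → ℝ) (p β L₁ L₂ K : ℝ) (hp : 1 ≤ p) (hβ : 0 < β)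
    (hρ_bdd : ∀ x, 1 / β ≤ ρ x ∧ ρ x ≤ β)
    (hρ_smooth : ContMDiff (𝓡 m) 𝓘(ℝ) ∞ ρ)
    (hρ_lip : ∀ x y, Fermat.geodesicEDist g x y ≠ ⊤ →
      |ρ x - ρ y| ≤ L₁ * (Fermat.geodesicEDist g x y).toReal)
    (hρ_hess : ∀ (x : M) (X Y : TangentSpace (𝓡 m) x),
      |Fermat.hessian g ρ x X Y| ≤ L₂ * √(g.inner x X X) * √(g.inner x Y Y))
    (hK : Fermat.SectionalCurvatureBoundedBy g K) :
    Fermat.SectionalCurvatureBoundedBy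
      (Fermat.fermatMetric g ρ hρ_smooth
        (fun x ↦ (one_div_pos.2 hβ).trans_le (hρ_bdd x).1) p)
      (β ^ (2 * (p - 1) / m) *
        (K + 3 * β ^ 2 * (p - 1) ^ 2 * L₁ ^ 2 / m ^ 2 + 2 * β ^ 2 * (p - 1) * L₁ ^ 2 / m
          + 2 * β * (p - 1) * L₂ / m)) := by
  intro x X Y hXY
  have hpos : ∀ x, 0 < ρ x := fun x ↦ (one_div_pos.2 hβ).trans_le (hρ_bdd x).1
  set y := extChartAt (𝓡 m) x x with hy
  set a : ℝ := (p - 1) / m with ha_def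
  have ha : 0 ≤ a := div_nonneg (by linarith) (Nat.cast_nonneg m)
  set f : EuclideanSpace ℝ (Fin m) → ℝ := ρ ∘ (extChartAt (𝓡 m) x).symm with hf_def
  set φ : EuclideanSpace ℝ (Fin m) → ℝ := fun z ↦ -a * Real.log (f z) with hφ_def
  set G := Fermat.metricInChart g x with hG_def
  have hyt : y ∈ (extChartAt (𝓡 m) x).target := mem_extChartAt_target x
  have hnhds := (isOpen_extChartAt_target (I := 𝓡 m) x).mem_nhds hyt
  have hfy : f y = ρ x := congrArg ρ (extChartAt_to_inv (I := 𝓡 m) x)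
  have hfpos : 0 < f y := hpos _
  have hf : ContDiffAt ℝ 2 f y :=
    ((hρ_smooth.contMDiffAt.comp y (Fermat.contMDiffAt_extChartAt_symm x hyt)).contDiffAt).of_le
      ENat.LEInfty.out
  have hG : ContDiffAt ℝ 2 G y :=
    (Fermat.contDiffAt_metricInChart g x hyt).of_le ENat.LEInfty.out
  have hφ : ContDiffAt ℝ 2 φ y := contDiffAt_const.mul (hf.log hfpos.ne')
  have hs : ∀ᶠ z in nhds y, ∀ u v, G z u v = G z v u :=
    Filter.Eventually.of_forall fun z u v ↦ Fermat.metricInChart_symm g x z u v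
  have hi : ∀ᶠ z in nhds y, (G z).IsInvertible := by
    filter_upwards [hnhds] with z hz
    exact Fermat.isInvertible_of_pos _ (Fermat.metricInChart_pos g x hz)
  have hB := Fermat.metricInChart_pos g x hyt
  have hsym : ∀ u v, G y u v = G y v u := hs.self_of_nhds
  have hind := Fermat.tangentCoord_linearIndependent hXY
  have hKXY := hK x X Y hXY
  -- every vector of the model space is the coordinate vector of a tangent vector
  have hsurj : ∀ v : EuclideanSpace ℝ (Fin m), ∃ V : TangentSpace (𝓡 m) x,
      Fermat.tangentCoord x V = v := fun v ↦ ⟨v, Fermat.tangentCoord_eq x v⟩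
  have hT := Fermat.abs_schoutenChange_le (G := G) (a := a) (β := β) (L₁ := L₁) (L₂ := L₂) hf
    hi.self_of_nhds hB ha hfpos
    (by
      rw [hfy]
      exact inv_le_of_inv_le₀ hβ (by simpa using (hρ_bdd x).1))
    (Fermat.abs_fderiv_le_of_lipschitz g hρ_smooth hρ_lip x)
    (fun v ↦ by
      obtain ⟨V, rfl⟩ := hsurj v
      have := hρ_hess x V V
      rw [← Fermat.metricInChart_tangentCoord] at this
      exact this)
  rw [Fermat.sectionalCurvature, ← Fermat.metricInChart_tangentCoord,
    ← Fermat.metricInChart_tangentCoord, ← Fermat.metricInChart_tangentCoord] at hKXY ⊢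
  simp only [Fermat.riemannTensor, Fermat.metricInChart_fermatMetric] at hKXY ⊢
  simp only [← hf_def, ← ha_def, ← hG_def, ← hy] at hKXY ⊢
  set U := Fermat.tangentCoord x X
  set V := Fermat.tangentCoord x Y
  have hgram := Fermat.gram_pos hB hsym hind
  have hKN := Fermat.abs_kulkarniNomizu_le hB hsym hT (X := U) (Y := V)
    (by simpa using hind.ne_zero 0)
    (fun s t ↦ Fermat.schoutenChange_smul_add_smul (hG.differentiableAt (by norm_num)) hs s t U V)
  have hcurv := Fermat.apply_curvature_conformal hG hφ hi hs U V
  simp only [smul_apply, smul_eq_mul]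
  rw [hcurv]
  set S := Fermat.schoutenChange G φ y U U * G y V V + Fermat.schoutenChange G φ y V V * G y U U
          - (Fermat.schoutenChange G φ y U V + Fermat.schoutenChange G φ y V U) * G y U V
  set R := G y (Fermat.curvature G y U V V) U
  set D := G y U U * G y V V - G y U V ^ 2 with hD
  set c := Real.exp (2 * (-a * Real.log (f y))) with hc_def
  have hc : 0 < c := Real.exp_pos _
  -- the conformal factor is `c = ρ ^ (-α)`
  have hc' : c⁻¹ ≤ β ^ (2 * (p - 1) / m) := by
    have h1 : c⁻¹ = ρ x ^ (2 * (p - 1) / m) := by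
      rw [hc_def, ← Real.exp_neg, Real.rpow_def_of_pos (hpos x), hfy, ha_def]
      congr 1
      ring
    rw [h1]
    refine Real.rpow_le_rpow (hpos x).le (hρ_bdd x).2 ?_
    exact div_nonneg (by linarith) (Nat.cast_nonneg m)
  rw [abs_div, abs_of_pos hgram, div_le_iff₀ hgram] at hKXY
  have hden : c * G y U U * (c * G y V V) - (c * G y U V) ^ 2 = c * (c * D) := by rw [hD]; ring
  rw [hden, mul_div_mul_left _ _ hc.ne', abs_div, abs_mul, abs_of_pos hc, abs_of_pos hgram]
  set C := a * β * L₂ + a * β ^ 2 * L₁ ^ 2 + 3 / 2 * a ^ 2 * β ^ 2 * L₁ ^ 2 with hC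
  -- as `R` is bounded by `K D` and the correction term `S` by `2 C D`
  have hRS : |R - S| / D ≤ K + 2 * C := by
    rw [div_le_iff₀ hgram]
    linarith [abs_sub R S]
  have hconst : K + 3 * β ^ 2 * (p - 1) ^ 2 * L₁ ^ 2 / m ^ 2 + 2 * β ^ 2 * (p - 1) * L₁ ^ 2 / m
      + 2 * β * (p - 1) * L₂ / m = K + 2 * C := by
    rw [hC, ha_def]
    ring
  rw [hconst]
  calc |R - S| / (c * D) = c⁻¹ * (|R - S| / D) := by
        rw [mul_comm c, ← div_div, div_eq_inv_mul _ c]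
    _ ≤ β ^ (2 * (p - 1) / m) * (K + 2 * C) :=
        mul_le_mul hc' hRS (div_nonneg (abs_nonneg _) hgram.le) (Real.rpow_nonneg hβ.le _)

end
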